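/- Let $\mathcal N=\mathbb N^{\mathbb N}$ be Baire space (the set of reals), with Turing reducibility $\le_T$, and let $\mathcal D$ be the set of Turing degrees; subsets of $\mathcal D$ are identified with the corresponding Turing closed subsets of $\mathcal N$ (those closed under Turing equivalence). A set $A\subseteq\mathcal N$ is \emph{cofinal in} $\mathcal D$ if for every $x\in\mathcal N$ there is $y\in A$ with $x\le_T y$. For $A\subseteq\mathcal N$, let $G_\omega(A)$ be the infinite game in which players I and II alternately play natural numbers, producing $x\in\mathcal N$, and I wins if and only if $x\in A$; it is determined if one of the players has a winning strategy. \emph{Borel Turing determinacy} is the statement that $G_\omega(A)$ is determined for every Turing closed Borel set $A\subseteq\mathcal N$. Corollary. Assume Borel Turing determinacy. If $(A_k)_{k<\omega}$ is a sequence of analytic sets of Turing degrees, each cofinal in $\mathcal D$, then $\bigcap_k A_k$ is cofinal in $\mathcal D$. -/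

import Mathlib

/-- Turing reducibility `x ≤_T y` between reals, i.e. elements of the Baire space `ℕ → ℕ`:
the total function `x` is recursive relative to the oracle `y`. -/
def RealTuringLE (x y : ℕ → ℕ) : Prop :=
  TuringReducible (x : ℕ →. ℕ) (y : ℕ →. ℕ)

/-- Turing equivalence of reals. -/
def RealTuringEquiv (x y : ℕ → ℕ) : Prop :=
  RealTuringLE x y ∧ RealTuringLE y x

/-- A set of reals is Turing closed if it is a union of Turing degrees.
Sets of Turing degrees are identified with Turing closed sets of reals. -/
def IsTuringClosed (A : Set (ℕ → ℕ)) : Prop :=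
  ∀ x y : ℕ → ℕ, RealTuringEquiv x y → x ∈ A → y ∈ A

/-- A set of reals is cofinal in the Turing degrees. -/
def IsTuringCofinal (A : Set (ℕ → ℕ)) : Prop :=
  ∀ x : ℕ → ℕ, ∃ y ∈ A, RealTuringLE x y

/-- The position reached after `n` moves of the play `x`: the list `[x 0, …, x (n - 1)]`. -/
def positionAt (x : ℕ → ℕ) (n : ℕ) : List ℕ :=
  (List.range n).map x

/-- Player I makes the moves `x 0, x 2, x 4, …` of the play `x`, and makes them according to the
strategy `σ`, which assigns a move to every position. -/
def PlayerOneFollows (σ : List ℕ → ℕ) (x : ℕ → ℕ) : Prop :=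
  ∀ n : ℕ, x (2 * n) = σ (positionAt x (2 * n))

/-- Player II makes the moves `x 1, x 3, x 5, …` of the play `x`, and makes them according to the
strategy `τ`, which assigns a move to every position. -/
def PlayerTwoFollows (τ : List ℕ → ℕ) (x : ℕ → ℕ) : Prop :=
  ∀ n : ℕ, x (2 * n + 1) = τ (positionAt x (2 * n + 1))

/-- The infinite game with payoff set `A`, in which player I wins the play `x` if `x ∈ A` and
player II wins it otherwise, is determined: one of the two players has a winning strategy. -/
def GameDetermined (A : Set (ℕ → ℕ)) : Prop :=
  (∃ σ : List ℕ → ℕ, ∀ x : ℕ → ℕ, PlayerOneFollows σ x → x ∈ A) ∨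
    (∃ τ : List ℕ → ℕ, ∀ x : ℕ → ℕ, PlayerTwoFollows τ x → x ∉ A)

/-- Borel Turing determinacy: the game with payoff set `A` is determined for every Turing closed
Borel set `A`. Borel sets are those of the Borel σ-algebra of the product topology. -/
def BorelTuringDeterminacy : Prop :=
  ∀ A : Set (ℕ → ℕ), @MeasurableSet (ℕ → ℕ) (borel (ℕ → ℕ)) A → IsTuringClosed A → GameDetermined A

/-! Intersecting each `A k` with the cone above a given real keeps it analytic, Turing closed and
cofinal, so a nonempty intersection is enough. If the intersection were empty, Novikov separation
would give Borel sets `B k ⊇ A k` with empty intersection. Each `turingCore (B k)` still contains `A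
k`, hence is cofinal, and it is Borel because the reals computable from `x` are listed by countably
many Borel functions of `x`. Determinacy and Martin's cone argument then put a cone inside each
core. Countably many cones share a point, which lies in every `B k`, a contradiction. -/

open MeasureTheory PiNat

/-! ### Novikov's generalised separation theorem -/

/-- A sequence of sets is jointly separable if its members have measurable supersets with empty
intersection. -/
def JointlySeparable {α : Type*} [MeasurableSpace α] (S : ℕ → Set α) : Prop :=
  ∃ B : ℕ → Set α, (∀ k, MeasurableSet (B k)) ∧ (∀ k, S k ⊆ B k) ∧ ⋂ k, B k = ∅

/-- Take unions of the separators at coordinate `j` and intersections elsewhere: a common point lies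
in some `B i j`, hence in every `B i k` for that `i`. -/
theorem JointlySeparable.of_cover {α : Type*} [MeasurableSpace α] {S : ℕ → Set α} (j : ℕ)
    {T : ℕ → ℕ → Set α} (hT : ∀ i, JointlySeparable (T i)) (hj : S j ⊆ ⋃ i, T i j)
    (hne : ∀ k, k ≠ j → ∀ i, S k ⊆ T i k) : JointlySeparable S := by
  choose B hB hTB hemp using hT
  refine ⟨fun k => if k = j then ⋃ i, B i k else ⋂ i, B i k, fun k => ?_, fun k => ?_, ?_⟩
  · dsimp only
    split_ifs
    · exact .iUnion fun i => hB i k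
    · exact .iInter fun i => hB i k
  · dsimp only
    split_ifs with h
    · subst h
      exact hj.trans (Set.iUnion_mono fun i => hTB i k)
    · exact Set.subset_iInter fun i => (hne k h i).trans (hTB i k)
  · refine Set.eq_empty_of_forall_notMem fun x hx => ?_
    rw [Set.mem_iInter] at hx
    obtain ⟨i, hi⟩ := Set.mem_iUnion.1 (by simpa using hx j)
    have : x ∈ ⋂ k, B i k := by
      refine Set.mem_iInter.2 fun k => ?_
      by_cases h : k = j
      · exact h ▸ hi
      · have := hx k
        rw [if_neg h] at this
        exact Set.mem_iInter.1 this i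
    simp [hemp i] at this

theorem jointlySeparable_of_disjoint_pair {α : Type*} [MeasurableSpace α] {S : ℕ → Set α}
    {i j : ℕ} {u v : Set α} (hu : MeasurableSet u) (hv : MeasurableSet v) (huv : Disjoint u v)
    (hi : S i ⊆ u) (hj : S j ⊆ v) : JointlySeparable S := by
  refine ⟨fun k => {x | (k = i → x ∈ u) ∧ (k = j → x ∈ v)}, fun k => ?_, fun k x hx => ?_, ?_⟩
  · exact (MeasurableSet.const _ |>.imp hu).inter (MeasurableSet.const _ |>.imp hv)
  · exact ⟨fun h => hi (h ▸ hx), fun h => hj (h ▸ hx)⟩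
  · refine Set.eq_empty_of_forall_notMem fun x hx => ?_
    rw [Set.mem_iInter] at hx
    exact Set.disjoint_left.1 huv ((hx i).1 rfl) ((hx j).2 rfl)

/-- One real `w` codes arguments for all the `f k`, so fixing one more entry refines a single
coordinate. Non-separability therefore survives along shrinking cylinders. At the limit `w` two of
the values differ, and continuity separates their images of a small cylinder. -/
theorem jointlySeparable_range {α : Type*} [TopologicalSpace α] [T2Space α] [MeasurableSpace α]
    [OpensMeasurableSpace α] {f : ℕ → (ℕ → ℕ) → α} (hf : ∀ k, Continuous (f k))
    (hemp : ⋂ k, Set.range (f k) = ∅) : JointlySeparable fun k => Set.range (f k) := by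
  let g : ℕ → (ℕ → ℕ) → α := fun k w => f k fun j => w (Nat.pair k j)
  have hg : ∀ k, Continuous (g k) := fun k =>
    (hf k).comp (continuous_pi fun j => continuous_apply _)
  by_contra hsep
  have step : ∀ n w, ¬ JointlySeparable (fun k => g k '' cylinder w n) →
      ∃ i, ¬ JointlySeparable (fun k => g k '' cylinder (Function.update w n i) (n + 1)) := by
    intro n w
    contrapose!
    intro h
    refine JointlySeparable.of_cover n.unpair.1 h ?_ ?_
    · rw [← Set.image_iUnion]
      exact Set.image_mono (iUnion_cylinder_update w n).ge
    · rintro k hk i _ ⟨w', hw', rfl⟩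
      refine ⟨Function.update w' n i, fun m hm => ?_, ?_⟩
      · rcases eq_or_ne m n with rfl | h
        · simp
        · rw [Function.update_of_ne h, Function.update_of_ne h]
          exact hw' m (by omega)
      -- Entry `n` is read only by coordinate `n.unpair.1`, so changing it leaves `g k` unaffected.
      · refine congrArg (f k) (funext fun j => Function.update_of_ne ?_ _ _)
        rintro rfl
        simp at hk
  choose! next hnext using step
  have h0 : ¬ JointlySeparable (fun k => g k '' cylinder (0 : ℕ → ℕ) 0) := by
    rintro ⟨B, hB, hsub, he⟩
    refine hsep ⟨B, hB, fun k => ?_, he⟩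
    rintro _ ⟨y, rfl⟩
    refine hsub k ⟨fun n => y n.unpair.2, by simp, ?_⟩
    simp [g]
  let s : ℕ → ℕ → ℕ := fun n => n.rec 0 fun n w => Function.update w n (next n w)
  have hs : ∀ n, ¬ JointlySeparable (fun k => g k '' cylinder (s n) n) := by
    intro n
    induction n with
    | zero => exact h0
    | succ n ih => exact hnext n _ ih
  let w : ℕ → ℕ := fun n => s (n + 1) n
  have hstab : ∀ m n, m < n → s n m = w m := by
    intro m n hmn
    induction n, hmn using Nat.le_induction with
    | base => rfl
    | succ n hn ih => exact (Function.update_of_ne (by omega) _ _).trans ih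
  have hw : ∀ n, ¬ JointlySeparable (fun k => g k '' cylinder w n) := by
    intro n
    have : cylinder w n = cylinder (s n) n :=
      mem_cylinder_iff_eq.1 fun m hm => (hstab m n hm).symm
    exact this ▸ hs n
  obtain ⟨i, j, hij⟩ : ∃ i j, g i w ≠ g j w := by
    by_contra! h
    have : g 0 w ∈ ⋂ k, Set.range (f k) := Set.mem_iInter.2 fun k => h 0 k ▸ ⟨_, rfl⟩
    simp [hemp] at this
  obtain ⟨u, v, hu, hv, hiu, hjv, huv⟩ := t2_separation hij
  have hnhds : (g i ⁻¹' u) ∩ (g j ⁻¹' v) ∈ nhds w :=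
    Filter.inter_mem ((hg i).continuousAt (hu.mem_nhds hiu)) ((hg j).continuousAt (hv.mem_nhds hjv))
  obtain ⟨_, ⟨y, n, rfl⟩, hwy, hn⟩ :=
    (isTopologicalBasis_cylinders fun _ : ℕ => ℕ).mem_nhds_iff.1 hnhds
  rw [← mem_cylinder_iff_eq.1 hwy] at hn
  exact hw n (jointlySeparable_of_disjoint_pair hu.measurableSet hv.measurableSet huv
    (Set.image_subset_iff.2 fun y hy => (hn hy).1) (Set.image_subset_iff.2 fun y hy => (hn hy).2))

/-- **Novikov's separation theorem**: a sequence of analytic sets with empty intersection has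
measurable supersets with empty intersection. -/
theorem jointlySeparable_of_analyticSet {α : Type*} [TopologicalSpace α] [T2Space α]
    [MeasurableSpace α] [OpensMeasurableSpace α] {A : ℕ → Set α} (hA : ∀ k, AnalyticSet (A k))
    (hemp : ⋂ k, A k = ∅) : JointlySeparable A := by
  by_cases h : ∃ k, A k = ∅
  · obtain ⟨k, hk⟩ := h
    exact jointlySeparable_of_disjoint_pair (i := k) (j := k) .empty .empty disjoint_bot_left
      hk.subset hk.subset
  · push Not at h
    have : ∀ k, ∃ f : (ℕ → ℕ) → α, Continuous f ∧ Set.range f = A k := fun k => by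
      have := hA k
      rw [AnalyticSet] at this
      exact this.resolve_left (h k).ne_empty
    choose f hf hfA using this
    obtain rfl : (fun k => Set.range (f k)) = A := funext hfA
    exact jointlySeparable_range hf hemp

/-! ### Oracle codes and measurability of Turing reducibility -/

/-- Codes for the partial functions recursive in an oracle. -/
inductive OracleCode : Type
  | zero | succ | left | right | oracle
  | pair (c d : OracleCode)
  | comp (c d : OracleCode)
  | prec (c d : OracleCode)
  | rfind (c : OracleCode)
  deriving Countable

/-- The partial function computed by a code with a given oracle. -/
def OracleCode.eval (y : ℕ → ℕ) : OracleCode → ℕ →. ℕ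
  | zero => fun _ => 0
  | succ => Nat.succ
  | left => fun n => (Nat.unpair n).1
  | right => fun n => (Nat.unpair n).2
  | oracle => y
  | pair c d => fun n => Nat.pair <$> c.eval y n <*> d.eval y n
  | comp c d => fun n => d.eval y n >>= c.eval y
  | prec c d => fun p =>
      let (a, n) := Nat.unpair p
      n.rec (c.eval y a) fun k IH => do
        let i ← IH
        d.eval y (Nat.pair a (Nat.pair k i))
  | rfind c => fun a => Nat.rfind fun n => (fun m => m = 0) <$> c.eval y (Nat.pair a n)

theorem exists_oracleCode_iff {y : ℕ → ℕ} {f : ℕ →. ℕ} :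
    Nat.RecursiveIn {(y : ℕ →. ℕ)} f ↔ ∃ c : OracleCode, c.eval y = f := by
  constructor
  · intro h
    induction h with
    | zero => exact ⟨.zero, rfl⟩
    | succ => exact ⟨.succ, rfl⟩
    | left => exact ⟨.left, rfl⟩
    | right => exact ⟨.right, rfl⟩
    | oracle g hg => exact ⟨.oracle, (Set.mem_singleton_iff.1 hg).symm⟩
    | pair _ _ ih₁ ih₂ =>
      obtain ⟨c, rfl⟩ := ih₁
      obtain ⟨d, rfl⟩ := ih₂
      exact ⟨.pair c d, rfl⟩
    | comp _ _ ih₁ ih₂ =>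
      obtain ⟨c, rfl⟩ := ih₁
      obtain ⟨d, rfl⟩ := ih₂
      exact ⟨.comp c d, rfl⟩
    | prec _ _ ih₁ ih₂ =>
      obtain ⟨c, rfl⟩ := ih₁
      obtain ⟨d, rfl⟩ := ih₂
      exact ⟨.prec c d, rfl⟩
    | rfind _ ih =>
      obtain ⟨c, rfl⟩ := ih
      exact ⟨.rfind c, rfl⟩
  · rintro ⟨c, rfl⟩
    induction c with
    | zero => exact .zero
    | succ => exact .succ
    | left => exact .left
    | right => exact .right
    | oracle => exact .oracle _ rfl
    | pair c d ihc ihd => exact .pair ihc ihd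
    | comp c d ihc ihd => exact .comp ihc ihd
    | prec c d ihc ihd => exact .prec ihc ihd
    | rfind c ih => exact .rfind ih

theorem realTuringLE_iff_exists_oracleCode {x y : ℕ → ℕ} :
    RealTuringLE x y ↔ ∃ c : OracleCode, ∀ n, x n ∈ c.eval y n := by
  rw [RealTuringLE, TuringReducible, RecursiveIn.iff_nat, exists_oracleCode_iff]
  refine exists_congr fun c => ⟨fun h n => by simp [h], fun h => funext fun n => ?_⟩
  exact Part.eq_some_iff.2 (h n)

/-- Intermediate values are natural numbers, so each way of building a code amounts to countable
unions and intersections. -/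
theorem OracleCode.measurableSet_mem_eval (c : OracleCode) (n m : ℕ) :
    MeasurableSet {y : ℕ → ℕ | m ∈ c.eval y n} := by
  induction c generalizing n m with
  | zero => exact .const (m ∈ (0 : Part ℕ))
  | succ => exact .const (m ∈ (Nat.succ : ℕ →. ℕ) n)
  | left => exact .const (m ∈ (Part.some (Nat.unpair n).1))
  | right => exact .const (m ∈ (Part.some (Nat.unpair n).2))
  | oracle =>
    have : {y : ℕ → ℕ | m ∈ oracle.eval y n} = (fun y : ℕ → ℕ => y n) ⁻¹' {m} := by
      ext y
      simp [eval, eq_comm]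
    rw [this]
    exact measurable_pi_apply n (measurableSet_singleton m)
  | pair c d ihc ihd =>
    have : {y : ℕ → ℕ | m ∈ (pair c d).eval y n} =
        ⋃ a, ⋃ b, {y | a ∈ c.eval y n} ∩ {y | b ∈ d.eval y n} ∩ {_y | Nat.pair a b = m} := by
      ext y
      simp [eval, Seq.seq]
      grind
    rw [this]
    exact .iUnion fun a => .iUnion fun b => ((ihc n a).inter (ihd n b)).inter (.const _)
  | comp c d ihc ihd =>
    have : {y : ℕ → ℕ | m ∈ (comp c d).eval y n} =
        ⋃ a, {y | a ∈ d.eval y n} ∩ {y | m ∈ c.eval y a} := by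
      ext y
      exact Part.mem_bind_iff.trans (by simp)
    rw [this]
    exact .iUnion fun a => (ihd n a).inter (ihc a m)
  | prec c d ihc ihd =>
    obtain ⟨a, k, rfl⟩ : ∃ a k, n = Nat.pair a k := ⟨_, _, (Nat.pair_unpair n).symm⟩
    induction k generalizing m with
    | zero => simpa [eval] using ihc a m
    | succ k ih =>
      have : {y : ℕ → ℕ | m ∈ (prec c d).eval y (Nat.pair a (k + 1))} =
          ⋃ i, {y | i ∈ (prec c d).eval y (Nat.pair a k)} ∩
            {y | m ∈ d.eval y (Nat.pair a (Nat.pair k i))} := by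
        ext y
        simp [eval]
      rw [this]
      exact .iUnion fun i => (ih i).inter (ihd _ m)
  | rfind c ih =>
    have : {y : ℕ → ℕ | m ∈ (rfind c).eval y n} =
        {y | 0 ∈ c.eval y (Nat.pair n m)} ∩
          ⋂ k, ⋂ _ : k < m, ⋃ j, {y | j + 1 ∈ c.eval y (Nat.pair n k)} := by
      ext y
      refine Nat.mem_rfind.trans ?_
      simp only [Set.mem_inter_iff, Set.mem_iInter, Set.mem_iUnion, Set.mem_ofPred_eq,
        Part.map_eq_map, Part.mem_map_iff]
      refine and_congr (by simp) (forall₂_congr fun k _ => ⟨?_, ?_⟩)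
      · rintro ⟨a, ha, h⟩
        obtain ⟨j, rfl⟩ := Nat.exists_eq_succ_of_ne_zero (of_decide_eq_false h)
        exact ⟨j, ha⟩
      · rintro ⟨j, hj⟩
        exact ⟨j + 1, hj, by simp⟩
    rw [this]
    exact (ih _ _).inter (.iInter fun k => .iInter fun _ => .iUnion fun j => ih _ _)

theorem OracleCode.measurableSet_computes (c : OracleCode) :
    MeasurableSet {p : (ℕ → ℕ) × (ℕ → ℕ) | ∀ n, p.1 n ∈ c.eval p.2 n} := by
  have : {p : (ℕ → ℕ) × (ℕ → ℕ) | ∀ n, p.1 n ∈ c.eval p.2 n} =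
      ⋂ n, ⋃ m, (fun p : (ℕ → ℕ) × (ℕ → ℕ) => p.1 n) ⁻¹' {m} ∩ Prod.snd ⁻¹' {y | m ∈ c.eval y n} := by
    ext p
    simp
  rw [this]
  exact .iInter fun n => .iUnion fun m =>
    (((measurable_pi_apply n).comp measurable_fst) (measurableSet_singleton m)).inter
      (measurable_snd (c.measurableSet_mem_eval n m))

theorem measurableSet_realTuringLE :
    MeasurableSet {p : (ℕ → ℕ) × (ℕ → ℕ) | RealTuringLE p.1 p.2} := by
  simp only [realTuringLE_iff_exists_oracleCode, Set.ofPred_exists]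
  exact .iUnion fun c => c.measurableSet_computes

/-- The real computed by a code with oracle `y`, with value `0` where the computation diverges. -/
noncomputable def OracleCode.evalReal (c : OracleCode) (y : ℕ → ℕ) : ℕ → ℕ := by
  classical exact fun n => if h : (c.eval y n).Dom then (c.eval y n).get h else 0

theorem OracleCode.evalReal_eq {c : OracleCode} {x y : ℕ → ℕ} (h : ∀ n, x n ∈ c.eval y n) :
    c.evalReal y = x := by
  funext n
  obtain ⟨hd, hx⟩ := h n
  rw [evalReal, dif_pos hd, hx]

theorem OracleCode.measurable_evalReal (c : OracleCode) : Measurable c.evalReal := by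
  refine measurable_pi_lambda _ fun n => measurable_to_countable' fun m => ?_
  -- The second set accounts for divergence, which yields the default value `0`.
  have : (fun y => c.evalReal y n) ⁻¹' {m} = {y | m ∈ c.eval y n} ∪
      ({_y | m = 0} ∩ ⋂ k, {y | k ∈ c.eval y n}ᶜ) := by
    ext y
    by_cases h : (c.eval y n).Dom
    · simp only [evalReal, h, dite_true, Set.mem_preimage, Set.mem_singleton_iff, Set.mem_union,
        Set.mem_ofPred_eq, Set.mem_inter_iff, Set.mem_iInter, Set.mem_compl_iff]
      refine ⟨fun e => .inl ⟨h, e⟩, ?_⟩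
      rintro (⟨_, e⟩ | ⟨_, e⟩)
      · exact e
      · exact absurd ⟨h, rfl⟩ (e _)
    · simp [evalReal, Part.eq_none_iff'.2 h, eq_comm]
  rw [this]
  exact (c.measurableSet_mem_eval n m).union
    ((MeasurableSet.const _).inter (.iInter fun k => (c.measurableSet_mem_eval n k).compl))

theorem measurableSet_upperCone (x : ℕ → ℕ) : MeasurableSet {y | RealTuringLE x y} :=
  measurable_prodMk_left measurableSet_realTuringLE

/-- The largest Turing closed subset of `B`. -/
def turingCore (B : Set (ℕ → ℕ)) : Set (ℕ → ℕ) :=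
  {x | ∀ y, RealTuringEquiv x y → y ∈ B}

/-- Every real computable from `x` is `c.evalReal x` for some code `c`, so the quantifier over the
degree of `x` becomes a countable one. -/
theorem measurableSet_turingCore {B : Set (ℕ → ℕ)} (hB : MeasurableSet B) :
    MeasurableSet (turingCore B) := by
  have : turingCore B = (⋃ c : OracleCode,
      (fun x => (c.evalReal x, x)) ⁻¹' {p | RealTuringLE p.1 p.2} ∩
        ((fun x => (x, c.evalReal x)) ⁻¹' {p | RealTuringLE p.1 p.2} ∩
          c.evalReal ⁻¹' Bᶜ))ᶜ := by
    ext x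
    simp only [turingCore, RealTuringEquiv, Set.mem_ofPred_eq, Set.mem_compl_iff, Set.mem_iUnion,
      Set.mem_inter_iff, Set.mem_preimage, not_exists]
    constructor
    · rintro h c ⟨h₁, h₂, h₃⟩
      exact h₃ (h _ ⟨h₂, h₁⟩)
    · rintro h y ⟨hxy, hyx⟩
      by_contra hy
      obtain ⟨c, hc⟩ := realTuringLE_iff_exists_oracleCode.1 hyx
      obtain rfl := OracleCode.evalReal_eq hc
      exact h c ⟨hyx, hxy, hy⟩
  rw [this]
  refine (MeasurableSet.iUnion fun c => ?_).compl
  exact ((c.measurable_evalReal.prodMk measurable_id) measurableSet_realTuringLE).inter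
    (((measurable_id.prodMk c.measurable_evalReal) measurableSet_realTuringLE).inter
      (c.measurable_evalReal hB.compl))

/-! ### Relative computability of reals -/

theorem RealTuringLE.refl (x : ℕ → ℕ) : RealTuringLE x x := TuringReducible.refl _

theorem RealTuringLE.trans {x y z : ℕ → ℕ} (hxy : RealTuringLE x y) (hyz : RealTuringLE y z) :
    RealTuringLE x z :=
  TuringReducible.trans hxy hyz

theorem RealTuringEquiv.symm {x y : ℕ → ℕ} (h : RealTuringEquiv x y) : RealTuringEquiv y x :=
  ⟨h.2, h.1⟩

theorem RealTuringEquiv.trans {x y z : ℕ → ℕ} (h : RealTuringEquiv x y)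
    (h' : RealTuringEquiv y z) : RealTuringEquiv x z :=
  ⟨h.1.trans h'.1, h'.2.trans h.2⟩

theorem Primrec.realTuringLE {f : ℕ → ℕ} (hf : Primrec f) (y : ℕ → ℕ) : RealTuringLE f y :=
  RecursiveIn.iff_nat.2 (Primrec.nat_iff.1 hf).recursiveIn

theorem RealTuringLE.comp {f g y : ℕ → ℕ} (hf : RealTuringLE f y) (hg : RealTuringLE g y) :
    RealTuringLE (fun n => f (g n)) y :=
  RecursiveIn.iff_nat.2 <|
    (Nat.RecursiveIn.comp (RecursiveIn.iff_nat.1 hf) (RecursiveIn.iff_nat.1 hg)).of_eq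
      fun _ => Part.bind_some _ _

theorem RealTuringLE.natPair {f g y : ℕ → ℕ} (hf : RealTuringLE f y) (hg : RealTuringLE g y) :
    RealTuringLE (fun n => Nat.pair (f n) (g n)) y :=
  RecursiveIn.iff_nat.2 <|
    (Nat.RecursiveIn.pair (RecursiveIn.iff_nat.1 hf) (RecursiveIn.iff_nat.1 hg)).of_eq
      fun n => by simp [Seq.seq]

theorem RealTuringLE.comp₂ {F : ℕ → ℕ → ℕ} (hF : Primrec₂ F) {f g y : ℕ → ℕ}
    (hf : RealTuringLE f y) (hg : RealTuringLE g y) : RealTuringLE (fun n => F (f n) (g n)) y := by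
  have hF' : Primrec fun p : ℕ => F p.unpair.1 p.unpair.2 := hF.comp
    (Primrec.fst.comp Primrec.unpair) (Primrec.snd.comp Primrec.unpair)
  simpa using (hF'.realTuringLE y).comp (hf.natPair hg)

theorem RealTuringLE.natRec {p h y : ℕ → ℕ} (hh : RealTuringLE h y)
    (hp : ∀ n, p (n + 1) = h (Nat.pair n (p n))) : RealTuringLE p y := by
  have hh' : RealTuringLE (fun m => h m.unpair.2) y :=
    hh.comp ((Primrec.snd.comp Primrec.unpair).realTuringLE y)
  have h₀ : RealTuringLE (fun _ => p 0) y := (Primrec.const _).realTuringLE y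
  have hpair : RealTuringLE (fun n => Nat.pair 0 n) y :=
    (Primrec₂.natPair.comp (Primrec.const 0) Primrec.id).realTuringLE y
  -- Primitive recursion carries a parameter; here it is a dummy, set to `0` by `hpair` and
  -- discarded by `hh'`.
  refine RecursiveIn.iff_nat.2 <| (Nat.RecursiveIn.comp (Nat.RecursiveIn.prec
    (RecursiveIn.iff_nat.1 h₀) (RecursiveIn.iff_nat.1 hh')) (RecursiveIn.iff_nat.1 hpair)).of_eq
      fun n => ?_
  induction n with
  | zero => simp
  | succ n ih =>
    simp at ih ⊢
    simp [ih, hp]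

theorem RealTuringLE.ite_even {f g y : ℕ → ℕ} {e : ℕ → ℕ} (he : RealTuringLE e y) (b : ℕ)
    (hf : RealTuringLE f y) (hg : RealTuringLE g y) :
    RealTuringLE (fun n => if e n % 2 = b then f n else g n) y := by
  have hF : Primrec₂ fun a q : ℕ => if a % 2 = b then q.unpair.1 else q.unpair.2 :=
    Primrec.ite (Primrec.eq.comp (Primrec.nat_mod.comp Primrec.fst (Primrec.const 2))
      (Primrec.const b)) (Primrec.fst.comp (Primrec.unpair.comp Primrec.snd))
      (Primrec.snd.comp (Primrec.unpair.comp Primrec.snd))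
  simpa using RealTuringLE.comp₂ hF he (hf.natPair hg)

theorem positionAt_succ (x : ℕ → ℕ) (n : ℕ) : positionAt x (n + 1) = positionAt x n ++ [x n] := by
  simp [positionAt, List.range_succ]

/-- Course-of-values recursion relative to an oracle. -/
theorem RealTuringLE.of_positionAt {x G y : ℕ → ℕ} (hG : RealTuringLE G y)
    (hx : ∀ n, x n = G (Nat.pair n (Encodable.encode (positionAt x n)))) : RealTuringLE x y := by
  have happ : Primrec₂ fun c a : ℕ =>
      Encodable.encode (((Encodable.decode (α := List ℕ) c).getD []) ++ [a]) :=
    Primrec.encode.comp (Primrec.list_append.comp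
      (Primrec.option_getD.comp (Primrec.decode.comp Primrec.fst) (Primrec.const []))
      (Primrec.list_cons.comp Primrec.snd (Primrec.const [])))
  have hp : RealTuringLE (fun n => Encodable.encode (positionAt x n)) y := by
    refine RealTuringLE.natRec (RealTuringLE.comp₂ happ
      ((Primrec.snd.comp Primrec.unpair).realTuringLE y) hG) fun n => ?_
    simp [positionAt_succ, ← hx]
  rw [show x = _ from funext hx]
  exact hG.comp ((Primrec.id.realTuringLE y).natPair hp)

/-- The real coding a strategy. -/
def strategyCode (σ : List ℕ → ℕ) (n : ℕ) : ℕ := σ ((Encodable.decode n).getD [])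

theorem exists_eq_apply_positionAt (G : ℕ → List ℕ → ℕ) :
    ∃ x : ℕ → ℕ, ∀ n, x n = G n (positionAt x n) := by
  let P : ℕ → List ℕ := fun n => n.rec [] fun n l => l ++ [G n l]
  have hP : ∀ n, positionAt (fun n => G n (P n)) n = P n := by
    intro n
    induction n with
    | zero => rfl
    | succ n ih => rw [positionAt_succ, ih]
  exact ⟨fun n => G n (P n), fun n => by rw [hP]⟩

/-- If `z` computes a strategy, then some play following the strategy at the moves of parity `b`
has the same Turing degree as `z`. -/
theorem exists_play_realTuringEquiv (σ : List ℕ → ℕ) {z : ℕ → ℕ}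
    (hz : RealTuringLE (strategyCode σ) z) {b : ℕ} (hb : b < 2) :
    ∃ x : ℕ → ℕ, (∀ n, x (2 * n + b) = σ (positionAt x (2 * n + b))) ∧ RealTuringEquiv x z := by
  -- The opponent plays out `z`, so `x` computes `z`; conversely `z` computes both the strategy and
  -- the opponent's moves.
  obtain ⟨x, hx⟩ := exists_eq_apply_positionAt fun n l => if n % 2 = b then σ l else z (n / 2)
  refine ⟨x, fun n => ?_, ?_, ?_⟩
  · rw [hx, if_pos (by omega)]
  · have hfst := (Primrec.fst.comp Primrec.unpair).realTuringLE z
    refine RealTuringLE.of_positionAt (RealTuringLE.ite_even hfst b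
      (hz.comp ((Primrec.snd.comp Primrec.unpair).realTuringLE z))
      ((RealTuringLE.refl z).comp ((Primrec.nat_div.comp
        (Primrec.fst.comp Primrec.unpair) (Primrec.const 2)).realTuringLE z))) fun n => ?_
    simpa [strategyCode] using hx n
  · have hzx : z = fun n => x (2 * n + (1 - b)) := by
      funext n
      rw [hx, if_neg (by omega)]
      congr 1
      omega
    rw [hzx]
    exact (RealTuringLE.refl x).comp ((Primrec.nat_add.comp (Primrec.nat_mul.comp
      (Primrec.const 2) Primrec.id) (Primrec.const (1 - b))).realTuringLE x)

/-- A sequence of reals has an upper bound in the Turing degrees. -/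
theorem exists_realTuringLE_bound (z : ℕ → ℕ → ℕ) : ∃ w, ∀ k, RealTuringLE (z k) w := by
  refine ⟨fun n => z n.unpair.1 n.unpair.2, fun k => ?_⟩
  simpa using (RealTuringLE.refl (fun n => z n.unpair.1 n.unpair.2)).comp
    ((Primrec₂.natPair.comp (Primrec.const k) Primrec.id).realTuringLE _)

theorem exists_realTuringLE_bound₂ (x y : ℕ → ℕ) : ∃ w, RealTuringLE x w ∧ RealTuringLE y w :=
  (exists_realTuringLE_bound fun k => if k = 0 then x else y).imp
    fun _ h => ⟨by simpa using h 0, by simpa using h 1⟩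

/-! ### Cones -/

/-- A set whose game is determined contains a cone if it is Turing closed and cofinal. -/
theorem GameDetermined.exists_cone_subset {B : Set (ℕ → ℕ)} (hdet : GameDetermined B)
    (hclosed : IsTuringClosed B) (hcof : IsTuringCofinal B) :
    ∃ w, ∀ z, RealTuringLE w z → z ∈ B := by
  rcases hdet with ⟨σ, hσ⟩ | ⟨τ, hτ⟩
  · refine ⟨strategyCode σ, fun z hz => ?_⟩
    obtain ⟨x, hx, hxz⟩ := exists_play_realTuringEquiv σ hz (b := 0) (by norm_num)
    exact hclosed x z hxz (hσ x hx)
  -- Player II cannot win: a member of `B` above the strategy is equivalent to a play following it,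
  -- which then also lies in `B`.
  · obtain ⟨z, hzB, hz⟩ := hcof (strategyCode τ)
    obtain ⟨x, hx, hxz⟩ := exists_play_realTuringEquiv τ hz (b := 1) (by norm_num)
    exact absurd (hclosed z x hxz.symm hzB) (hτ x hx)

theorem isTuringClosed_turingCore (B : Set (ℕ → ℕ)) : IsTuringClosed (turingCore B) :=
  fun _ _ hxy hx z hyz => hx z (hxy.trans hyz)

theorem turingCore_subset (B : Set (ℕ → ℕ)) : turingCore B ⊆ B :=
  fun x hx => hx x ⟨.refl x, .refl x⟩

theorem IsTuringClosed.subset_turingCore {A B : Set (ℕ → ℕ)} (hA : IsTuringClosed A)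
    (hAB : A ⊆ B) : A ⊆ turingCore B :=
  fun x hx y hxy => hAB (hA x y hxy hx)

theorem IsTuringCofinal.mono {A B : Set (ℕ → ℕ)} (hA : IsTuringCofinal A) (hAB : A ⊆ B) :
    IsTuringCofinal B :=
  fun x => (hA x).imp fun _ h => ⟨hAB h.1, h.2⟩

/-- Under Borel Turing determinacy, countably many cofinal analytic sets of Turing degrees have a
common element. -/
theorem BorelTuringDeterminacy.nonempty_iInter (hdet : BorelTuringDeterminacy)
    {A : ℕ → Set (ℕ → ℕ)} (hA : ∀ k, AnalyticSet (A k)) (hclosed : ∀ k, IsTuringClosed (A k))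
    (hcof : ∀ k, IsTuringCofinal (A k)) : (⋂ k, A k).Nonempty := by
  by_contra hemp
  obtain ⟨B, hB, hAB, hBe⟩ :=
    jointlySeparable_of_analyticSet hA (Set.not_nonempty_iff_eq_empty.1 hemp)
  have hcone : ∀ k, ∃ w, ∀ z, RealTuringLE w z → z ∈ turingCore (B k) := by
    intro k
    have hm := measurableSet_turingCore (hB k)
    rw [BorelSpace.measurable_eq (α := ℕ → ℕ)] at hm
    exact (hdet _ hm (isTuringClosed_turingCore _)).exists_cone_subset
      (isTuringClosed_turingCore _) ((hcof k).mono ((hclosed k).subset_turingCore (hAB k)))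
  choose w hw using hcone
  obtain ⟨z, hz⟩ := exists_realTuringLE_bound w
  have : z ∈ ⋂ k, B k := Set.mem_iInter.2 fun k => turingCore_subset _ (hw k z (hz k))
  simp [hBe] at this

theorem mainTheorem8 (hdet : BorelTuringDeterminacy) (A : ℕ → Set (ℕ → ℕ))
    (hanalytic : ∀ k, MeasureTheory.AnalyticSet (A k))
    (hclosed : ∀ k, IsTuringClosed (A k))
    (hcofinal : ∀ k, IsTuringCofinal (A k)) :
    IsTuringCofinal (⋂ k, A k) := by
  intro x
  suffices h : (⋂ k, A k ∩ {y | RealTuringLE x y}).Nonempty by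
    obtain ⟨y, hy⟩ := h
    rw [Set.mem_iInter] at hy
    exact ⟨y, Set.mem_iInter.2 fun k => (hy k).1, (hy 0).2⟩
  refine hdet.nonempty_iInter (fun k => ?_) (fun k => ?_) (fun k w => ?_)
  · rw [Set.inter_eq_iInter]
    exact .iInter (Bool.rec (measurableSet_upperCone x).analyticSet (hanalytic k))
  · exact fun y z hyz hy => ⟨hclosed k y z hyz hy.1, hy.2.trans hyz.1⟩
  -- A member of `A k` above both `x` and `w` witnesses cofinality within the cone above `x`.
  · obtain ⟨v, hxv, hwv⟩ := exists_realTuringLE_bound₂ x w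
    obtain ⟨y, hy, hvy⟩ := hcofinal k v
    exact ⟨y, ⟨hy, hxv.trans hvy⟩, hwv.trans hvy⟩
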